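/- Let $\Gamma$ be a finite set with $N=\operatorname{card}(\Gamma)>1$ elements, and let $\mathcal D_N$ be the Dyck inverse monoid (polycyclic monoid), i.e. the monoid with zero generated by $\gamma(-),\gamma(+)$, $\gamma\in\Gamma$, with the relations $\gamma(-)\gamma(+)=\mathbf 1$ and $\gamma(-)\gamma'(+)=0$ for $\gamma\ne\gamma'$. Let $G$ be the labeled directed graph with two vertices $v_{even},v_{odd}$, one edge from $v_{even}$ to $v_{odd}$ and one edge from $v_{odd}$ to $v_{even}$, both labeled $0$, a loop at $v_{even}$ labeled $1$ (so far, the Fischer automaton of the even shift), and, for every $\gamma\in\Gamma$, two further loops $e(\gamma(-))$ and $e(\gamma(+))$ at $v_{even}$, each labeled by itself. Put $\varphi(0)=\varphi(1)=\mathbf 1$, $\varphi(e(\gamma(-)))=\gamma(-)$, $\varphi(e(\gamma(+)))=\gamma(+)$. The Schröder shift $Sch_N$ is the set of all bi-infinite sequences $x$ over the alphabet $\{0,1\}\cup\{e(\gamma(-)),e(\gamma(+)):\gamma\in\Gamma\}$ such that every finite word $a_1\cdots a_I$ appearing in $x$ is the label sequence of a path in $G$ and satisfies $\varphi(a_1)\cdots\varphi(a_I)\neq0$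 in $\mathcal D_N$. Let $P_n(Sch_N)$ be the set of its points of period $n$ (not necessarily least period) under the shift, and $$\zeta_{Sch_N}(z)=\exp\Big(\sum_{n\ge1}\tfrac1n\operatorname{card}(P_n(Sch_N))\,z^n\Big).$$ Then, as formal power series in $z$ with rational coefficients, where the square root denotes the one with constant term $1$, $$\zeta_{Sch_N}(z)=\frac{2(1+z)\Big(1-z-z^2+\sqrt{(1-z-z^2)^2-4Nz^2}\Big)}{\Big(1-(2N+1)z-z^2+\sqrt{(1-z-z^2)^2-4Nz^2}\Big)^2}.$$ -/

import Mathlib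

open PowerSeries

/-! ### Zeta functions of shift invariant sets -/

/-- The shift `(x i) ↦ (x (i + 1))` on bi-infinite sequences. -/
def shiftMap {A : Type*} (x : ℤ → A) : ℤ → A := fun i => x (i + 1)

/-- The points of `Y` that have period `n` (not necessarily least period) under the shift. -/
def periodicPoints {A : Type*} (Y : Set (ℤ → A)) (n : ℕ) : Set (ℤ → A) :=
  {x ∈ Y | Function.IsPeriodicPt shiftMap n x}

/-- The zeta function `exp (∑_{n ≥ 1} (card P_n(Y) / n) z ^ n)`, as a formal power series in `z`.
The coefficient of `z ^ 0` in the exponent is `_ / 0 = 0`. -/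
noncomputable def zetaSeries {A : Type*} (Y : Set (ℤ → A)) : ℚ⟦X⟧ :=
  (PowerSeries.exp ℚ).subst
    (PowerSeries.mk fun n : ℕ => ((periodicPoints Y n).ncard : ℚ) / (n : ℚ))

/-! ### Square roots of formal power series with constant term one -/

/-- `√f = (1 + (f - 1)) ^ (1 / 2)` by the binomial series, for `f` with constant term `1`. -/
noncomputable def sqrtSeries (f : ℚ⟦X⟧) : ℚ⟦X⟧ :=
  (PowerSeries.binomialSeries ℚ (1 / 2 : ℚ)).subst (f - 1)

theorem hasSubst_sub_one {f : ℚ⟦X⟧} (hf : constantCoeff f = 1) : HasSubst (f - 1) :=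
  HasSubst.of_constantCoeff_zero' (by simp [hf])

/-- `sqrtSeries f` squares to `f`. -/
theorem sqrtSeries_sq {f : ℚ⟦X⟧} (hf : constantCoeff f = 1) : sqrtSeries f ^ 2 = f := by
  have h := hasSubst_sub_one hf
  have h1 : PowerSeries.binomialSeries ℚ (1 / 2 : ℚ) * PowerSeries.binomialSeries ℚ (1 / 2 : ℚ)
      = 1 + X := by
    rw [← PowerSeries.binomialSeries_add]
    have := PowerSeries.binomialSeries_nat (R := ℚ) (A := ℚ) 1
    norm_num at this ⊢
    exact this
  have h2 : (1 + X : ℚ⟦X⟧).subst (f - 1) = f := by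
    rw [← PowerSeries.coe_substAlgHom h, map_add, map_one, PowerSeries.substAlgHom_X h]
    ring
  rw [sqrtSeries, pow_two, ← PowerSeries.subst_mul h, h1, h2]

/-- `sqrtSeries f` has constant term `1`; with `sqrtSeries_sq` this determines it. -/
theorem constantCoeff_sqrtSeries {f : ℚ⟦X⟧} (hf : constantCoeff f = 1) :
    constantCoeff (sqrtSeries f) = 1 := by
  have h0 : constantCoeff (f - 1) = 0 := by simp [hf]
  have h1 : PowerSeries.binomialSeries ℚ (1 / 2 : ℚ)
      = 1 + (PowerSeries.binomialSeries ℚ (1 / 2 : ℚ) - 1) := by ring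
  have h := hasSubst_sub_one hf
  have h2 : constantCoeff
      ((PowerSeries.binomialSeries ℚ (1 / 2 : ℚ) - 1 : ℚ⟦X⟧).subst (f - 1) : ℚ⟦X⟧) = 0 :=
    PowerSeries.constantCoeff_subst_eq_zero h0 _ (by simp)
  rw [sqrtSeries, h1, PowerSeries.subst_add h, map_add, h2,
    ← PowerSeries.coe_substAlgHom h, map_one]
  simp

/-! ### The Dyck inverse monoid (polycyclic monoid) -/

/-- The generators `γ(-)` and `γ(+)`. -/
inductive DyckGen (Γ : Type*)
  | neg (γ : Γ) : DyckGen Γ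
  | pos (γ : Γ) : DyckGen Γ

/-- The defining relations `γ(-) γ(+) = 1` and `γ(-) γ'(+) = 0` for `γ ≠ γ'`, on the free monoid
with zero over the generators. -/
inductive DyckRel (Γ : Type*) :
    WithZero (FreeMonoid (DyckGen Γ)) → WithZero (FreeMonoid (DyckGen Γ)) → Prop
  | same (γ : Γ) :
      DyckRel Γ ((FreeMonoid.of (DyckGen.neg γ) * FreeMonoid.of (DyckGen.pos γ) :
        FreeMonoid (DyckGen Γ)) : WithZero (FreeMonoid (DyckGen Γ))) 1
  | diff (γ γ' : Γ) (h : γ ≠ γ') :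
      DyckRel Γ ((FreeMonoid.of (DyckGen.neg γ) * FreeMonoid.of (DyckGen.pos γ') :
        FreeMonoid (DyckGen Γ)) : WithZero (FreeMonoid (DyckGen Γ))) 0

/-- The Dyck inverse monoid over `Γ`: the monoid with zero that is presented by the generators
`γ(-)`, `γ(+)` and the relations `DyckRel`. -/
abbrev DyckMonoid (Γ : Type*) : Type _ := (conGen (DyckRel Γ)).Quotient

namespace DyckMonoid

/-- The class of an element of the free monoid with zero. -/
def proj (Γ : Type*) : WithZero (FreeMonoid (DyckGen Γ)) →* DyckMonoid Γ := (conGen (DyckRel Γ)).mk'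

/-- The generator `γ(-)`. -/
def neg {Γ : Type*} (γ : Γ) : DyckMonoid Γ := proj Γ (FreeMonoid.of (DyckGen.neg γ))

/-- The generator `γ(+)`. -/
def pos {Γ : Type*} (γ : Γ) : DyckMonoid Γ := proj Γ (FreeMonoid.of (DyckGen.pos γ))

/-- The zero element. -/
def zero (Γ : Type*) : DyckMonoid Γ := proj Γ 0

end DyckMonoid

/-! ### Labeled directed graphs and the subshifts built from them -/

/-- A directed graph with vertex set `V` and edge set `E` (loops and multiple edges are allowed),
whose edges are labeled by symbols in `A`. -/
structure LabeledGraph (V E A : Type*) where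
  src : E → V
  tgt : E → V
  lab : E → A

/-- The loops `e(γ(-), k)`, `1 ≤ k ≤ Km γ`, and `e(γ(+), k)`, `1 ≤ k ≤ Kp γ`
(`k` is counted from `0` here). -/
inductive LoopSym {Γ : Type*} (Km Kp : Γ → ℕ)
  | neg (γ : Γ) (k : Fin (Km γ)) : LoopSym Km Kp
  | pos (γ : Γ) (k : Fin (Kp γ)) : LoopSym Km Kp

namespace LabeledGraph

variable {V E A Γ : Type*}

/-- A list of edges is a path if every edge ends where the next one starts. -/
def IsPath (G : LabeledGraph V E A) (p : List E) : Prop :=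
  p.IsChain (fun e f => G.tgt e = G.src f)

/-- The graph obtained from `G` by attaching to the vertex `v` the loops `e(γ(∓), k)`, which are
labeled by themselves. -/
def attachLoops (G : LabeledGraph V E A) (v : V) (Km Kp : Γ → ℕ) :
    LabeledGraph V (E ⊕ LoopSym Km Kp) (A ⊕ LoopSym Km Kp) where
  src := Sum.elim G.src (fun _ => v)
  tgt := Sum.elim G.tgt (fun _ => v)
  lab := Sum.map G.lab id

/-- The map `φ` from symbols to the Dyck inverse monoid: the symbols of `G` go to `1`, and the
symbols `e(γ(∓), k)` go to `γ(∓)`. -/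
def phi {Km Kp : Γ → ℕ} : A ⊕ LoopSym Km Kp → DyckMonoid Γ
  | Sum.inl _ => 1
  | Sum.inr (LoopSym.neg γ _) => DyckMonoid.neg γ
  | Sum.inr (LoopSym.pos γ _) => DyckMonoid.pos γ

/-- A path in the graph with the attached loops is admissible if the images under `φ` of its labels
have a nonzero product in the Dyck inverse monoid. -/
def AdmissiblePath (G : LabeledGraph V E A) (v : V) (Km Kp : Γ → ℕ)
    (p : List (E ⊕ LoopSym Km Kp)) : Prop :=
  (G.attachLoops v Km Kp).IsPath p ∧
    ((p.map (G.attachLoops v Km Kp).lab).map phi).prod ≠ DyckMonoid.zero Γ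

/-- A word is admissible if it is the label sequence of an admissible path. -/
def AdmissibleWord (G : LabeledGraph V E A) (v : V) (Km Kp : Γ → ℕ)
    (w : List (A ⊕ LoopSym Km Kp)) : Prop :=
  ∃ p, G.AdmissiblePath v Km Kp p ∧ p.map (G.attachLoops v Km Kp).lab = w

/-- The subshift of all bi-infinite sequences in which only admissible words appear. -/
def subshift (G : LabeledGraph V E A) (v : V) (Km Kp : Γ → ℕ) : Set (ℤ → A ⊕ LoopSym Km Kp) :=
  {x | ∀ (i : ℤ) (n : ℕ), G.AdmissibleWord v Km Kp (List.ofFn fun k : Fin n => x (i + (k : ℤ)))}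

end LabeledGraph

/-! ### The Schröder shift -/

/-- The vertices of the Fischer automaton of the even shift. -/
inductive EvenVertex
  | even
  | odd

/-- The edges of the Fischer automaton of the even shift. -/
inductive EvenEdge
  | evenToOdd
  | oddToEven
  | loop

/-- The right Fischer automaton of the even shift: both edges between the two vertices carry the
label `0`, the loop at the vertex `even` carries the label `1`. -/
def evenAutomaton : LabeledGraph EvenVertex EvenEdge (Fin 2) where
  src
    | .evenToOdd => .even
    | .oddToEven => .odd
    | .loop => .even
  tgt
    | .evenToOdd => .odd
    | .oddToEven => .even
    | .loop => .even
  lab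
    | .evenToOdd => 0
    | .oddToEven => 0
    | .loop => 1

/-- The Schröder shift over `Γ`: one loop for each `γ(-)` and one for each `γ(+)` are attached to
the vertex `even` of the even automaton. -/
def schroederShift (Γ : Type*) :
    Set (ℤ → Fin 2 ⊕ LoopSym (fun _ : Γ => 1) (fun _ : Γ => 1)) :=
  evenAutomaton.subshift EvenVertex.even (fun _ : Γ => 1) (fun _ : Γ => 1)

/-! Write z for `X`. Both sides have constant term 1, so it suffices to compare logarithmic
derivatives; z times that of the zeta function is the generating function of the numbers of
n-periodic points, n ≥ 1.

For n ≥ 1 an n-periodic point is the repetition of a word w of length n (`ncard_periodicPoints`).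
Nonzero elements of the Dyck monoid have a normal form `posProd p * negProd q`. All powers of such
an element are nonzero as soon as its square is, and this happens exactly when p and the reverse of
q are prefix-comparable. Hence w qualifies iff it labels a closed path with compatible normal form,
or w = 0ⁿ (`mem_schroederShift_iff`).

The number of words with prescribed end vertices and normal form depends only on m = |p| + |q|. For
paths from `even` to `even` the series is D (zD)^m with D = 1 + (z + z²) D + N z² D²: m prescribed
unmatched letters separate m + 1 words of trivial image (`wordCount_reads`). There are N^max(i,j)
compatible pairs with |p| = i, |q| = j. With W(t) = (1 + Nt) / ((1 - Nt²)(1 - Nt)) as their series,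
cycles at `even` contribute D W(zD), nonempty cycles at `odd` z² D W(zD).

Only 0ⁿ can be a cycle at both vertices: it is counted twice for even n and missed for odd n. The
correction -(-1)ⁿ sums to z/(1 + z), which yields the factor 1 + z. Everything integrates to (1 + z)
D / (1 - NzD)² (`derivative_closedForm`), which is the stated quotient (`closedForm_eq`). -/

/-! ### Formal power series -/

/-- A power series with given logarithmic derivative is determined by its constant term. -/
theorem PowerSeries.eq_of_logDeriv_eq {f g h : ℚ⟦X⟧} (hf : derivative ℚ f = h * f)
    (hg : derivative ℚ g = h * g) (hg0 : constantCoeff g ≠ 0)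
    (hfg : constantCoeff f = constantCoeff g) : f = g := by
  have hgg : g * g⁻¹ = 1 := PowerSeries.mul_inv_cancel g hg0
  have key : f * g⁻¹ = 1 := by
    apply PowerSeries.derivative.ext
    · rw [Derivation.leibniz, derivative_inv', hf, hg, derivative_one]
      simp only [smul_eq_mul]
      linear_combination (-(f * h * g⁻¹)) * hgg
    · rw [map_mul, hfg, ← map_mul, hgg]
  linear_combination g * key - f * hgg

/-- The coefficients of `G * f.subst u` when `u` has no constant term. -/
theorem PowerSeries.coeff_mul_subst {u : ℚ⟦X⟧} (hu : constantCoeff u = 0) (G f : ℚ⟦X⟧) (n : ℕ) :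
    coeff n (G * f.subst u) = ∑ m ∈ Finset.range (n + 1), coeff m f * coeff n (G * u ^ m) := by
  have hs : HasSubst u := HasSubst.of_constantCoeff_zero' hu
  have hsub : ∀ b ≤ n, coeff b (f.subst u : ℚ⟦X⟧)
      = ∑ m ∈ Finset.range (n + 1), coeff m f * coeff b (u ^ m) := by
    intro b hb
    rw [coeff_subst' hs, finsum_eq_sum_of_support_subset (s := Finset.range (n + 1))]
    · simp
    · intro d hd
      by_contra hdn
      simp only [Finset.coe_range, Set.mem_Iio, not_lt] at hdn
      apply hd
      -- `u ^ d` has order at least d > b, so the infinite sum can be cut off at n.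
      have : coeff b (u ^ d) = 0 := by
        apply PowerSeries.coeff_of_lt_order
        refine lt_of_lt_of_le ?_ (PowerSeries.le_order_pow_of_constantCoeff_eq_zero d hu)
        exact_mod_cast (by omega : b < d)
      simp [this]
  rw [coeff_mul]
  simp_rw [coeff_mul]
  have : ∀ p ∈ Finset.HasAntidiagonal.antidiagonal n, coeff p.1 G * coeff p.2 (f.subst u : ℚ⟦X⟧)
      = ∑ m ∈ Finset.range (n + 1), coeff m f * (coeff p.1 G * coeff p.2 (u ^ m)) := by
    intro p hp
    rw [hsub p.2 (by have := Finset.HasAntidiagonal.mem_antidiagonal.mp hp; omega), Finset.mul_sum]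
    exact Finset.sum_congr rfl fun m _ => by ring
  rw [Finset.sum_congr rfl this, Finset.sum_comm]
  simp_rw [Finset.mul_sum]

theorem constantCoeff_zetaExponent {A : Type*} (Y : Set (ℤ → A)) :
    constantCoeff (PowerSeries.mk fun n : ℕ => ((periodicPoints Y n).ncard : ℚ) / (n : ℚ)) = 0 := by
  simp [← coeff_zero_eq_constantCoeff_apply]

theorem constantCoeff_zetaSeries {A : Type*} (Y : Set (ℤ → A)) :
    constantCoeff (zetaSeries Y) = 1 := by
  have hs := HasSubst.of_constantCoeff_zero' (constantCoeff_zetaExponent Y)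
  have h2 : constantCoeff ((PowerSeries.exp ℚ - 1 : ℚ⟦X⟧).subst
      (PowerSeries.mk fun n : ℕ => ((periodicPoints Y n).ncard : ℚ) / (n : ℚ)) : ℚ⟦X⟧) = 0 :=
    PowerSeries.constantCoeff_subst_eq_zero (constantCoeff_zetaExponent Y) _ (by simp)
  have h1 : PowerSeries.exp ℚ = 1 + (PowerSeries.exp ℚ - 1) := by ring
  rw [zetaSeries, h1, PowerSeries.subst_add hs, map_add, h2, ← PowerSeries.coe_substAlgHom hs,
    map_one]
  simp

theorem derivative_zetaSeries {A : Type*} (Y : Set (ℤ → A)) :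
    derivative ℚ (zetaSeries Y)
      = (PowerSeries.mk fun n : ℕ => ((periodicPoints Y (n + 1)).ncard : ℚ)) * zetaSeries Y := by
  have hs := HasSubst.of_constantCoeff_zero' (constantCoeff_zetaExponent Y)
  rw [zetaSeries, derivative_subst hs, derivative_exp, mul_comm]
  congr 1
  ext n
  rw [coeff_derivative, coeff_mk, coeff_mk]
  push_cast
  field_simp

/-! ### The generating function of Dyck words -/

/-- The power series `D` with `D = 1 + (z + z²) D + N z² D²`. -/
noncomputable def dyckSeries (N : ℕ) : ℚ⟦X⟧ :=
  2 * (1 - X - X ^ 2 + sqrtSeries ((1 - X - X ^ 2) ^ 2 - 4 * (N : ℚ⟦X⟧) * X ^ 2))⁻¹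

theorem constantCoeff_discriminant (N : ℕ) :
    constantCoeff ((1 - X - X ^ 2) ^ 2 - 4 * (N : ℚ⟦X⟧) * X ^ 2) = 1 := by
  simp

theorem dyckSeries_mul (N : ℕ) : dyckSeries N *
    (1 - X - X ^ 2 + sqrtSeries ((1 - X - X ^ 2) ^ 2 - 4 * (N : ℚ⟦X⟧) * X ^ 2)) = 2 := by
  rw [dyckSeries, mul_assoc, PowerSeries.inv_mul_cancel, mul_one]
  simp [constantCoeff_sqrtSeries (constantCoeff_discriminant N)]

/-- The quadratic formula with rationalised denominator: 1 - z - z² + S has constant term 2 and is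
invertible, whereas 2Nz² is not. Squaring D S = 2 - D (1 - z - z²) gives four times the equation. -/
theorem dyckSeries_eq (N : ℕ) : dyckSeries N
    = 1 + (X + X ^ 2) * dyckSeries N + (N : ℚ⟦X⟧) * X ^ 2 * dyckSeries N ^ 2 := by
  have hS := sqrtSeries_sq (constantCoeff_discriminant N)
  have hD := dyckSeries_mul N
  set S := sqrtSeries ((1 - X - X ^ 2) ^ 2 - 4 * (N : ℚ⟦X⟧) * X ^ 2)
  set D := dyckSeries N
  have h4 : (4 : ℚ⟦X⟧) * (D - (1 + (X + X ^ 2) * D + (N : ℚ⟦X⟧) * X ^ 2 * D ^ 2)) = 0 := by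
    linear_combination (D * S + 2 - D * (1 - X - X ^ 2)) * hD - D ^ 2 * hS
  have h40 : (4 : ℚ⟦X⟧) ≠ 0 := fun h => by
    have h' := congrArg constantCoeff h
    rw [map_ofNat, map_zero] at h'
    norm_num at h'
  exact sub_eq_zero.mp ((mul_eq_zero.mp h4).resolve_left h40)

/-- The generating function of the numbers of pairs of prefix-comparable words of total length
`m` over an alphabet with `N` letters. -/
noncomputable def comparableSeries (N : ℕ) : ℚ⟦X⟧ :=
  PowerSeries.mk fun m => ∑ ij ∈ Finset.HasAntidiagonal.antidiagonal m, (N : ℚ) ^ max ij.1 ij.2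

/-- Lowering both lengths by one divides the count by N, so the factor 1 - Nz² leaves only the pairs
with an empty component; these form a geometric series. -/
theorem comparableSeries_eq (N : ℕ) :
    (1 - (N : ℚ⟦X⟧) * X ^ 2) * (1 - (N : ℚ⟦X⟧) * X) * comparableSeries N
      = 1 + (N : ℚ⟦X⟧) * X := by
  have hN : (N : ℚ⟦X⟧) = C (N : ℚ) := by simp
  have h1 : (1 - (N : ℚ⟦X⟧) * X ^ 2) * comparableSeries N
      = PowerSeries.mk fun n => if n = 0 then 1 else 2 * (N : ℚ) ^ n := by
    ext n
    rw [sub_mul, one_mul, hN, mul_assoc, map_sub, coeff_C_mul, coeff_X_pow_mul', coeff_mk]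
    match n with
    | 0 => simp [comparableSeries]
    | 1 => simp [comparableSeries, Finset.Nat.antidiagonal_succ]; ring
    | m + 2 =>
      simp only [comparableSeries, coeff_mk, Finset.Nat.antidiagonal_succ_succ']
      simp [Finset.sum_map, pow_succ, ← Finset.sum_mul]
      ring
  have h2 : (1 - (N : ℚ⟦X⟧) * X) * (PowerSeries.mk fun n => if n = 0 then 1 else 2 * (N : ℚ) ^ n)
      = 1 + (N : ℚ⟦X⟧) * X := by
    ext n
    rw [sub_mul, one_mul, hN, mul_assoc, map_sub, coeff_C_mul, map_add, coeff_C_mul]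
    match n with
    | 0 => simp
    | 1 => simp [coeff_succ_X_mul]; ring
    | m + 2 =>
      rw [coeff_succ_X_mul]
      simp [coeff_X, coeff_one]; ring
  rw [mul_comm (1 - (N : ℚ⟦X⟧) * X ^ 2), mul_assoc, h1, h2]

theorem coeff_mul_subst_comparableSeries (N : ℕ) (G : ℚ⟦X⟧) (n : ℕ) :
    coeff n (G * (comparableSeries N).subst (X * dyckSeries N))
      = ∑ m ∈ Finset.range (n + 1), (∑ ij ∈ Finset.HasAntidiagonal.antidiagonal m, (N : ℚ) ^ max ij.1 ij.2)
          * coeff n (G * (X * dyckSeries N) ^ m) := by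
  rw [PowerSeries.coeff_mul_subst (by simp)]
  simp [comparableSeries]

theorem subst_comparableSeries_eq (N : ℕ) :
    (1 - (N : ℚ⟦X⟧) * (X * dyckSeries N) ^ 2) * (1 - (N : ℚ⟦X⟧) * (X * dyckSeries N))
        * (comparableSeries N).subst (X * dyckSeries N)
      = 1 + (N : ℚ⟦X⟧) * (X * dyckSeries N) := by
  have hs : HasSubst (X * dyckSeries N) := HasSubst.of_constantCoeff_zero' (by simp)
  have h := congrArg (PowerSeries.substAlgHom (R := ℚ) hs) (comparableSeries_eq N)
  simpa only [map_mul, map_sub, map_add, map_one, map_pow, map_natCast,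
    PowerSeries.substAlgHom_X, PowerSeries.coe_substAlgHom] using h

/-- The closed form of the zeta function in terms of `dyckSeries`. -/
theorem closedForm_eq (N : ℕ) :
    (2 * (1 + X) *
        (1 - X - X ^ 2 + sqrtSeries ((1 - X - X ^ 2) ^ 2 - 4 * (N : ℚ⟦X⟧) * X ^ 2))) *
      ((1 - (2 * (N : ℚ⟦X⟧) + 1) * X - X ^ 2 +
        sqrtSeries ((1 - X - X ^ 2) ^ 2 - 4 * (N : ℚ⟦X⟧) * X ^ 2)) ^ 2)⁻¹
      = (1 + X) * dyckSeries N * (1 - (N : ℚ⟦X⟧) * (X * dyckSeries N))⁻¹ ^ 2 := by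
  have hD := dyckSeries_mul N
  have hS1 := constantCoeff_sqrtSeries (constantCoeff_discriminant N)
  set S := sqrtSeries ((1 - X - X ^ 2) ^ 2 - 4 * (N : ℚ⟦X⟧) * X ^ 2)
  set D := dyckSeries N
  set I := (1 - (N : ℚ⟦X⟧) * (X * D))⁻¹
  have hI : (1 - (N : ℚ⟦X⟧) * (X * D)) * I = 1 :=
    PowerSeries.mul_inv_cancel _ (by simp)
  symm
  rw [PowerSeries.eq_mul_inv_iff_mul_eq (by simp [hS1])]
  set Y := 1 - X - X ^ 2 + S with hY
  -- Since D Y = 2, the base of the squared denominator is Y - 2NX = Y (1 - NXD).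
  have hYI : (1 - (2 * (N : ℚ⟦X⟧) + 1) * X - X ^ 2 + S) * I = Y := by
    linear_combination Y * hI + (N : ℚ⟦X⟧) * X * I * hD + I * hY.symm
  calc _ = (1 + X) * D * ((1 - (2 * (N : ℚ⟦X⟧) + 1) * X - X ^ 2 + S) * I) ^ 2 := by ring
    _ = _ := by rw [hYI]; linear_combination (1 + X) * Y * hD

theorem derivative_closedForm (N : ℕ) :
    X * derivative ℚ ((1 + X) * dyckSeries N * (1 - (N : ℚ⟦X⟧) * (X * dyckSeries N))⁻¹ ^ 2)
      = ((1 + X ^ 2) * dyckSeries N * (comparableSeries N).subst (X * dyckSeries N)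
          - 1 + X * (1 + X)⁻¹) *
        ((1 + X) * dyckSeries N * (1 - (N : ℚ⟦X⟧) * (X * dyckSeries N))⁻¹ ^ 2) := by
  have hD := dyckSeries_eq N
  have hW := subst_comparableSeries_eq N
  set D := dyckSeries N
  set W : ℚ⟦X⟧ := (comparableSeries N).subst (X * D)
  set I := (1 - (N : ℚ⟦X⟧) * (X * D))⁻¹ with hIdef
  have hI : (1 - (N : ℚ⟦X⟧) * (X * D)) * I = 1 :=
    PowerSeries.mul_inv_cancel _ (by simp)
  have hJ : (1 + X : ℚ⟦X⟧) * (1 + X)⁻¹ = 1 := PowerSeries.mul_inv_cancel _ (by simp)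
  set J := (1 + X : ℚ⟦X⟧)⁻¹
  have hN : derivative ℚ (N : ℚ⟦X⟧) = 0 := by
    simp
  set D' := derivative ℚ D with hD'
  have hI' : derivative ℚ I = I ^ 2 * ((N : ℚ⟦X⟧) * (D + X * D')) := by
    rw [hIdef, derivative_inv', map_sub, Derivation.leibniz, Derivation.leibniz, hN,
      derivative_X, derivative_one]
    simp only [smul_eq_mul]
    ring
  have hDD : D' = (1 + 2 * X) * D + (X + X ^ 2) * D' + (N : ℚ⟦X⟧) * (2 * X * D ^ 2)
      + (N : ℚ⟦X⟧) * X ^ 2 * (2 * D * D') := by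
    have h := congrArg (derivative ℚ) hD
    simp only [map_add, Derivation.leibniz, Derivation.leibniz_pow, hN, derivative_X,
      derivative_one, smul_eq_mul, nsmul_eq_mul] at h
    push_cast at h
    linear_combination h
  -- The differentiated quadratic equation solved for D': its coefficient 1 - X - X² - 2NX²D, times
  -- D, equals 1 - N(XD)² by the equation itself.
  have hXD : X * D' * (1 - (N : ℚ⟦X⟧) * (X * D) ^ 2)
      = D * (X * D + 2 * X ^ 2 * D + 2 * (N : ℚ⟦X⟧) * (X * D) ^ 2) := by
    linear_combination X * D * hDD - X * D' * hD
  -- The logarithmic derivative of D I², multiplied by X D and by the denominators of W.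
  have hlog : (1 - (N : ℚ⟦X⟧) * (X * D) ^ 2) * (1 - (N : ℚ⟦X⟧) * (X * D)) *
      (X * D' + 2 * D * I * X * ((N : ℚ⟦X⟧) * (D + X * D')))
      = (1 - (N : ℚ⟦X⟧) * (X * D) ^ 2) * (1 - (N : ℚ⟦X⟧) * (X * D)) *
      (((1 + X ^ 2) * D * W - 1) * D) := by
    linear_combination 2 * D * (1 - (N : ℚ⟦X⟧) * (X * D) ^ 2) * X * ((N : ℚ⟦X⟧) * (D + X * D')) * hI
      + (1 - (N : ℚ⟦X⟧) * (X * D)) * hXD + 2 * D * (N : ℚ⟦X⟧) * X * hXD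
      - (1 + X ^ 2) * D ^ 2 * hW - D * (1 + (N : ℚ⟦X⟧) * (X * D)) * hD
  have h0 : (1 - (N : ℚ⟦X⟧) * (X * D) ^ 2) * (1 - (N : ℚ⟦X⟧) * (X * D)) ≠ 0 := by
    intro h
    simpa using congrArg constantCoeff h
  have hlog' := mul_left_cancel₀ h0 hlog
  have h1X : derivative ℚ (1 + X : ℚ⟦X⟧) = 1 := by simp
  rw [Derivation.leibniz, Derivation.leibniz, Derivation.leibniz_pow, hI', h1X]
  simp only [smul_eq_mul, nsmul_eq_mul]
  push_cast
  linear_combination (1 + X) * I ^ 2 * hlog' - X * D * I ^ 2 * hJ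

/-! ### Normal forms in the Dyck inverse monoid -/

namespace DyckMonoid

variable {Γ : Type*}

/-- The product of the generators `γ(+)` over a list. -/
def posProd (p : List Γ) : DyckMonoid Γ := (p.map pos).prod

/-- The product of the generators `γ(-)` over a list. -/
def negProd (q : List Γ) : DyckMonoid Γ := (q.map neg).prod

@[simp] theorem posProd_nil : posProd ([] : List Γ) = 1 := rfl

@[simp] theorem negProd_nil : negProd ([] : List Γ) = 1 := rfl

theorem posProd_cons (γ : Γ) (p : List Γ) : posProd (γ :: p) = pos γ * posProd p := by
  simp [posProd]

theorem negProd_cons (γ : Γ) (q : List Γ) : negProd (γ :: q) = neg γ * negProd q := by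
  simp [negProd]

theorem posProd_append (p p' : List Γ) : posProd (p ++ p') = posProd p * posProd p' := by
  simp [posProd]

theorem negProd_append (q q' : List Γ) : negProd (q ++ q') = negProd q * negProd q' := by
  simp [negProd]

theorem zero_mul' (x : DyckMonoid Γ) : zero Γ * x = zero Γ := by
  obtain ⟨x, rfl⟩ := Con.mk'_surjective x
  change proj Γ 0 * proj Γ x = proj Γ 0
  rw [← map_mul, zero_mul]

theorem mul_zero' (x : DyckMonoid Γ) : x * zero Γ = zero Γ := by
  obtain ⟨x, rfl⟩ := Con.mk'_surjective x
  change proj Γ x * proj Γ 0 = proj Γ 0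
  rw [← map_mul, mul_zero]

theorem neg_mul_pos_same (γ : Γ) : neg γ * pos γ = 1 := by
  rw [neg, pos, ← map_mul, ← map_one (proj Γ), ← WithZero.coe_mul]
  exact (Con.eq _).mpr (ConGen.Rel.of _ _ (DyckRel.same γ))

theorem neg_mul_pos_diff {γ γ' : Γ} (h : γ ≠ γ') : neg γ * pos γ' = zero Γ := by
  rw [neg, pos, ← map_mul, zero, ← WithZero.coe_mul]
  exact (Con.eq _).mpr (ConGen.Rel.of _ _ (DyckRel.diff γ γ' h))

/-- `γ(-)` acts on functions on stacks by `f ↦ (s ↦ f (γ :: s))`. -/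
def popEnd (γ : Γ) : Module.End ℤ (List Γ → ℤ) where
  toFun f s := f (γ :: s)
  map_add' _ _ := rfl
  map_smul' _ _ := rfl

open Classical in
/-- `γ(+)` acts on functions on stacks by extending from the stacks with top symbol `γ`. -/
noncomputable def pushEnd (γ : Γ) : Module.End ℤ (List Γ → ℤ) where
  toFun f s := match s with
    | [] => 0
    | γ' :: s => if γ' = γ then f s else 0
  map_add' f g := by
    ext s
    rcases s with _ | ⟨γ', s⟩
    · simp
    · by_cases h : γ' = γ <;> simp [h]
  map_smul' c f := by
    ext s
    rcases s with _ | ⟨γ', s⟩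
    · simp
    · by_cases h : γ' = γ <;> simp [h]

theorem popEnd_apply (γ : Γ) (f : List Γ → ℤ) (s : List Γ) : popEnd γ f s = f (γ :: s) := rfl

theorem pushEnd_cons_self (γ : Γ) (f : List Γ → ℤ) (s : List Γ) :
    pushEnd γ f (γ :: s) = f s := by
  simp [pushEnd]

theorem pushEnd_cons_of_ne {γ γ' : Γ} (h : γ' ≠ γ) (f : List Γ → ℤ) (s : List Γ) :
    pushEnd γ f (γ' :: s) = 0 := by
  simp [pushEnd, h]

/-- The action of the generators on functions on stacks. -/
noncomputable def genEnd : DyckGen Γ → Module.End ℤ (List Γ → ℤ)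
  | .neg γ => popEnd γ
  | .pos γ => pushEnd γ

/-- The representation of the free monoid with zero on functions on stacks. -/
noncomputable def freeRep (Γ : Type*) :
    WithZero (FreeMonoid (DyckGen Γ)) →*₀ Module.End ℤ (List Γ → ℤ) :=
  WithZero.lift' (FreeMonoid.lift genEnd)

theorem freeRep_of (g : DyckGen Γ) :
    freeRep Γ ((FreeMonoid.of g : FreeMonoid (DyckGen Γ)) : WithZero _) = genEnd g := by
  simp [freeRep]

/-- The representation of the Dyck inverse monoid on functions on stacks. -/
noncomputable def rep (Γ : Type*) : DyckMonoid Γ →* Module.End ℤ (List Γ → ℤ) :=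
  Con.lift _ (freeRep Γ : WithZero (FreeMonoid (DyckGen Γ)) →* _) (by
    rw [Con.conGen_le]
    intro x y hxy
    rw [Con.ker_rel]
    cases hxy with
    | same γ =>
      simp only [MonoidHom.coe_coe, WithZero.coe_mul, map_mul, freeRep_of, map_one]
      ext f s
      exact pushEnd_cons_self γ f s
    | diff γ γ' h =>
      simp only [MonoidHom.coe_coe, WithZero.coe_mul, map_mul, freeRep_of, map_zero]
      ext f s
      exact pushEnd_cons_of_ne h f s)

theorem rep_proj (x : WithZero (FreeMonoid (DyckGen Γ))) : rep Γ (proj Γ x) = freeRep Γ x := rfl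

theorem rep_neg (γ : Γ) : rep Γ (neg γ) = popEnd γ := by
  rw [neg, rep_proj, freeRep_of]; rfl

theorem rep_pos (γ : Γ) : rep Γ (pos γ) = pushEnd γ := by
  rw [pos, rep_proj, freeRep_of]; rfl

theorem rep_zero : rep Γ (zero Γ) = 0 := by
  rw [zero, rep_proj, map_zero]

theorem rep_negProd (q : List Γ) (f : List Γ → ℤ) (s : List Γ) :
    rep Γ (negProd q) f s = f (q.reverse ++ s) := by
  induction q generalizing s with
  | nil => simp
  | cons γ q ih => simp [negProd_cons, rep_neg, popEnd_apply, ih]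

theorem rep_posProd (p : List Γ) (f : List Γ → ℤ) : rep Γ (posProd p) f p = f [] := by
  induction p with
  | nil => simp
  | cons γ p ih => simp [posProd_cons, rep_pos, pushEnd_cons_self, ih]

/-- The operator sends the constant function 1 to a function with value 1 at the stack p, so it is
not the zero operator. -/
theorem posProd_mul_negProd_ne_zero (p q : List Γ) : posProd p * negProd q ≠ zero Γ := by
  intro h
  have h1 := congrFun (DFunLike.congr_fun (congrArg (rep Γ) h) fun _ => (1 : ℤ)) p
  rw [map_mul, Module.End.mul_apply, rep_posProd, rep_negProd, rep_zero] at h1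
  exact one_ne_zero h1

theorem one_ne_zero' : (1 : DyckMonoid Γ) ≠ zero Γ := by
  simpa using posProd_mul_negProd_ne_zero ([] : List Γ) []

theorem negProd_reverse_mul_posProd_append (l r : List Γ) :
    negProd l.reverse * posProd (l ++ r) = posProd r := by
  induction l with
  | nil => simp
  | cons γ l ih =>
    rw [List.reverse_cons, negProd_append, negProd_cons, negProd_nil, mul_one, List.cons_append,
      posProd_cons, mul_assoc, ← mul_assoc (neg γ), neg_mul_pos_same, one_mul, ih]

theorem negProd_reverse_append_mul_posProd (l r : List Γ) :
    negProd (l ++ r).reverse * posProd l = negProd r.reverse := by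
  have h := negProd_reverse_mul_posProd_append l []
  rw [List.append_nil, posProd_nil] at h
  rw [List.reverse_append, negProd_append, mul_assoc, h, mul_one]

theorem negProd_reverse_mul_posProd_eq_zero (l p : List Γ) (h : ¬ (l <+: p ∨ p <+: l)) :
    negProd l.reverse * posProd p = zero Γ := by
  induction l generalizing p with
  | nil => simp at h
  | cons γ l ih =>
    rcases p with _ | ⟨γ', p⟩
    · simp at h
    · rw [List.reverse_cons, negProd_append, negProd_cons, negProd_nil, mul_one, posProd_cons,
        mul_assoc, ← mul_assoc (neg γ)]
      by_cases hγ : γ = γ'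
      · subst hγ
        rw [neg_mul_pos_same, one_mul, ih]
        simpa [List.cons_prefix_cons] using h
      · rw [neg_mul_pos_diff hγ, zero_mul', mul_zero']

/-- The normal form `posProd p * negProd q` is compatible with itself: no letters clash in
`negProd q * posProd p`. -/
def Compatible (p q : List Γ) : Prop := q.reverse <+: p ∨ p <+: q.reverse

theorem sq_eq_zero_of_not_compatible {p q : List Γ} (h : ¬ Compatible p q) :
    posProd p * negProd q * (posProd p * negProd q) = zero Γ := by
  have := negProd_reverse_mul_posProd_eq_zero q.reverse p h
  rw [List.reverse_reverse] at this
  rw [mul_assoc, ← mul_assoc (negProd q), this, zero_mul', mul_zero']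

theorem mul_pow_eq (a b : DyckMonoid Γ) (k : ℕ) : (a * b) ^ (k + 1) = a * (b * a) ^ k * b := by
  induction k with
  | zero => simp
  | succ k ih => rw [pow_succ, ih, pow_succ (b * a)]; simp only [mul_assoc]

theorem exists_posProd_pow (r : List Γ) (k : ℕ) : ∃ l, posProd r ^ k = posProd l := by
  induction k with
  | zero => exact ⟨[], by simp⟩
  | succ k ih =>
    obtain ⟨l, hl⟩ := ih
    exact ⟨l ++ r, by rw [pow_succ, hl, posProd_append]⟩

theorem exists_negProd_pow (r : List Γ) (k : ℕ) : ∃ l, negProd r ^ k = negProd l := by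
  induction k with
  | zero => exact ⟨[], by simp⟩
  | succ k ih =>
    obtain ⟨l, hl⟩ := ih
    exact ⟨l ++ r, by rw [pow_succ, hl, negProd_append]⟩

/-- Write the power as a (ba)^k b. Compatibility reduces ba to a product of generators of one sign
only, so the whole is again a normal form. -/
theorem pow_ne_zero_of_compatible {p q : List Γ} (h : Compatible p q) (k : ℕ) :
    (posProd p * negProd q) ^ k ≠ zero Γ := by
  rcases k with _ | k
  · rw [pow_zero]; exact one_ne_zero'
  rw [mul_pow_eq]
  rcases h with ⟨r, hr⟩ | ⟨r, hr⟩
  · have h1 := negProd_reverse_mul_posProd_append q.reverse r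
    rw [List.reverse_reverse, hr] at h1
    obtain ⟨l, hl⟩ := exists_posProd_pow r k
    rw [h1, hl, ← posProd_append]
    exact posProd_mul_negProd_ne_zero _ _
  · have h1 := negProd_reverse_append_mul_posProd p r
    rw [hr, List.reverse_reverse] at h1
    obtain ⟨l, hl⟩ := exists_negProd_pow r.reverse k
    rw [h1, hl, mul_assoc, ← negProd_append]
    exact posProd_mul_negProd_ne_zero _ _

end DyckMonoid

/-! ### Reading words of the Schröder shift from right to left -/

namespace Schroeder

open DyckMonoid

variable {Γ : Type*}

/-- The alphabet of the Schröder shift. -/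
abbrev Sym (Γ : Type*) := Fin 2 ⊕ LoopSym (fun _ : Γ => 1) (fun _ : Γ => 1)

open Classical in
/-- Left multiplication of the normal form `posProd p * negProd q` by the image of a symbol. -/
noncomputable def monoidStep : Sym Γ → List Γ × List Γ → Option (List Γ × List Γ)
  | .inl _, s => some s
  | .inr (.pos γ _), (p, q) => some (γ :: p, q)
  | .inr (.neg γ _), ([], q) => some ([], γ :: q)
  | .inr (.neg γ _), (γ' :: p, q) => if γ = γ' then some (p, q) else none

/-- The normal form of the image of a word, `none` if the image is zero. -/
noncomputable def normalForm : List (Sym Γ) → Option (List Γ × List Γ)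
  | [] => some ([], [])
  | a :: w => (normalForm w).bind (monoidStep a)

/-- The element of the Dyck inverse monoid with a given normal form. -/
def ofNormalForm : Option (List Γ × List Γ) → DyckMonoid Γ
  | none => zero Γ
  | some s => posProd s.1 * negProd s.2

theorem ofNormalForm_step (a : Sym Γ) (s : List Γ × List Γ) :
    LabeledGraph.phi a * ofNormalForm (some s) = ofNormalForm (monoidStep a s) := by
  obtain ⟨p, q⟩ := s
  rcases a with a | ⟨γ, k⟩ | ⟨γ, k⟩
  · simp [LabeledGraph.phi, monoidStep]
  · rcases p with _ | ⟨γ', p⟩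
    · simp [LabeledGraph.phi, monoidStep, ofNormalForm, negProd_cons]
    · simp only [LabeledGraph.phi, monoidStep, ofNormalForm, posProd_cons]
      rw [← mul_assoc, ← mul_assoc]
      by_cases h : γ = γ'
      · subst h
        simp [neg_mul_pos_same]
      · rw [neg_mul_pos_diff h, zero_mul', zero_mul', if_neg h]
  · simp [LabeledGraph.phi, monoidStep, ofNormalForm, posProd_cons, mul_assoc]

theorem prod_map_phi (w : List (Sym Γ)) :
    (w.map LabeledGraph.phi).prod = ofNormalForm (normalForm w) := by
  induction w with
  | nil => simp [normalForm, ofNormalForm]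
  | cons a w ih =>
    rw [List.map_cons, List.prod_cons, ih, normalForm]
    rcases normalForm w with _ | s
    · exact mul_zero' _
    · exact ofNormalForm_step a s

theorem prod_map_phi_ne_zero_iff (w : List (Sym Γ)) :
    (w.map LabeledGraph.phi).prod ≠ zero Γ ↔ ∃ s, normalForm w = some s := by
  rw [prod_map_phi]
  rcases normalForm w with _ | s
  · simp [ofNormalForm]
  · simpa [ofNormalForm] using posProd_mul_negProd_ne_zero s.1 s.2

theorem exists_compatible_of_prod_ne_zero {w : List (Sym Γ)}
    (h : ((w ++ w).map LabeledGraph.phi).prod ≠ zero Γ) :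
    ∃ p q, normalForm w = some (p, q) ∧ Compatible p q := by
  rw [List.map_append, List.prod_append, prod_map_phi] at h
  rcases hs : normalForm w with _ | ⟨p, q⟩
  · rw [hs] at h
    exact absurd (zero_mul' _) h
  · refine ⟨p, q, rfl, ?_⟩
    by_contra hc
    rw [hs] at h
    exact h (sq_eq_zero_of_not_compatible hc)

/-- All powers of a word with compatible normal form have nonzero image. -/
theorem prod_pow_ne_zero {w : List (Sym Γ)} {p q : List Γ} (hw : normalForm w = some (p, q))
    (hc : Compatible p q) (k : ℕ) : (w.map LabeledGraph.phi).prod ^ k ≠ zero Γ := by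
  rw [prod_map_phi, hw]
  exact pow_ne_zero_of_compatible hc k

theorem length_normalForm {w : List (Sym Γ)} {p q : List Γ} (h : normalForm w = some (p, q)) :
    p.length + q.length ≤ w.length := by
  induction w generalizing p q with
  | nil => simp [normalForm] at h; simp [h]
  | cons a w ih =>
    rw [normalForm, Option.bind_eq_some_iff] at h
    obtain ⟨⟨p', q'⟩, h1, h2⟩ := h
    have := ih h1
    rcases a with a | ⟨γ, k⟩ | ⟨γ, k⟩
    · simp only [monoidStep, Option.some.injEq, Prod.mk.injEq] at h2
      obtain ⟨rfl, rfl⟩ := h2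
      simp; omega
    · rcases p' with _ | ⟨γ', p'⟩
      · simp only [monoidStep, Option.some.injEq, Prod.mk.injEq] at h2
        obtain ⟨rfl, rfl⟩ := h2
        simp at this ⊢; omega
      · simp only [monoidStep, Option.ite_none_right_eq_some, Option.some.injEq,
          Prod.mk.injEq] at h2
        obtain ⟨_, rfl, rfl⟩ := h2
        simp at this ⊢; omega
    · simp only [monoidStep, Option.some.injEq, Prod.mk.injEq] at h2
      obtain ⟨rfl, rfl⟩ := h2
      simp; omega

end Schroeder

/-! ### Counting words by a property -/

section WordCount

variable {A : Type*} [Fintype A]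

open Classical in
/-- The number of words of length `n` with the property `P`. -/
noncomputable def wordCount (n : ℕ) (P : List A → Prop) : ℕ :=
  (Finset.univ.filter fun w : Fin n → A => P (List.ofFn w)).card

theorem wordCount_congr {n : ℕ} {P Q : List A → Prop} (h : ∀ w, w.length = n → (P w ↔ Q w)) :
    wordCount n P = wordCount n Q := by
  unfold wordCount
  congr 1
  ext w
  simp [h (List.ofFn w) (by simp)]

theorem wordCount_eq_zero {n : ℕ} {P : List A → Prop} (h : ∀ w, w.length = n → ¬ P w) :
    wordCount n P = 0 := by
  unfold wordCount
  rw [Finset.card_eq_zero]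
  ext w
  simpa using h (List.ofFn w) (by simp)

open Classical in
theorem wordCount_zero (P : List A → Prop) : wordCount 0 P = if P [] then 1 else 0 := by
  unfold wordCount
  split_ifs with h
  · rw [Finset.filter_true_of_mem fun w _ => by simpa using h]
    simp
  · rw [Finset.filter_false_of_mem fun w _ => by simpa using h]
    simp

theorem wordCount_succ (n : ℕ) (P : List A → Prop) :
    wordCount (n + 1) P = ∑ a, wordCount n fun w => P (a :: w) := by
  simp only [wordCount, Finset.card_filter]
  rw [← Fintype.sum_prod_type']
  refine (Fintype.sum_equiv (Fin.consEquiv fun _ => A) _ _ fun x => ?_).symm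
  rw [Fin.consEquiv, Equiv.coe_fn_mk, List.ofFn_cons]

theorem wordCount_or {n : ℕ} {P Q : List A → Prop} (h : ∀ w, w.length = n → P w → ¬ Q w) :
    wordCount n (fun w => P w ∨ Q w) = wordCount n P + wordCount n Q := by
  classical
  unfold wordCount
  rw [← Finset.card_union_of_disjoint]
  · congr 1
    ext w
    simp
  · rw [Finset.disjoint_filter]
    exact fun w _ => h _ (by simp)

end WordCount

/-! ### Recursion for the number of words with given end vertices and normal form -/

namespace Schroeder

open DyckMonoid

variable {Γ : Type*}

/-- Reading a symbol backwards from a vertex of the Schröder graph. -/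
def vertexStep : Sym Γ → EvenVertex → Option EvenVertex
  | .inl a, .even => if a = 0 then some .odd else some .even
  | .inl a, .odd => if a = 0 then some .even else none
  | .inr _, .even => some .even
  | .inr _, .odd => none

/-- The source of the path with a given label that ends in `v`, if it exists. -/
def sourceVertex (v : EvenVertex) : List (Sym Γ) → Option EvenVertex
  | [] => some v
  | a :: w => (sourceVertex v w).bind (vertexStep a)

/-- The loops attached for the Schröder shift are indexed by two copies of `Γ`. -/
def loopSymEquiv (Γ : Type*) : Γ ⊕ Γ ≃ LoopSym (fun _ : Γ => 1) (fun _ : Γ => 1) where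
  toFun := Sum.elim (fun γ => .neg γ 0) (fun γ => .pos γ 0)
  invFun
    | .neg γ _ => .inl γ
    | .pos γ _ => .inr γ
  left_inv x := by rcases x with x | x <;> rfl
  right_inv x := by
    rcases x with ⟨γ, k⟩ | ⟨γ, k⟩ <;> simp [Subsingleton.elim k 0]

noncomputable instance [Fintype Γ] : Fintype (LoopSym (fun _ : Γ => 1) (fun _ : Γ => 1)) :=
  Fintype.ofEquiv _ (loopSymEquiv Γ)

theorem sum_sym [Fintype Γ] {M : Type*} [AddCommMonoid M] (f : Sym Γ → M) :
    ∑ a, f a = f (.inl 0) + f (.inl 1)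
      + (∑ γ, f (.inr (.neg γ 0)) + ∑ γ, f (.inr (.pos γ 0))) := by
  rw [Fintype.sum_sum_type, Fin.sum_univ_two, ← (loopSymEquiv Γ).sum_comp, Fintype.sum_sum_type]
  rfl

/-- A path with label `w` leads from `u` to `v`, and `w` has the normal form `(p, q)`. -/
def Reads (v u : EvenVertex) (p q : List Γ) (w : List (Sym Γ)) : Prop :=
  sourceVertex v w = some u ∧ normalForm w = some (p, q)

theorem reads_nil {v u : EvenVertex} {p q : List Γ} :
    Reads v u p q [] ↔ v = u ∧ p = [] ∧ q = [] := by
  simp [Reads, sourceVertex, normalForm, eq_comm]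

theorem reads_zero_odd {v : EvenVertex} {p q : List Γ} {w : List (Sym Γ)} :
    Reads v .odd p q (.inl 0 :: w) ↔ Reads v .even p q w := by
  unfold Reads
  rw [sourceVertex, normalForm]
  rcases sourceVertex v w with _ | _ | _ <;> rcases normalForm w with _ | s <;>
    simp [vertexStep, monoidStep]

theorem reads_zero_even {v : EvenVertex} {p q : List Γ} {w : List (Sym Γ)} :
    Reads v .even p q (.inl 0 :: w) ↔ Reads v .odd p q w := by
  unfold Reads
  rw [sourceVertex, normalForm]
  rcases sourceVertex v w with _ | _ | _ <;> rcases normalForm w with _ | s <;>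
    simp [vertexStep, monoidStep]

theorem reads_one_even {v : EvenVertex} {p q : List Γ} {w : List (Sym Γ)} :
    Reads v .even p q (.inl 1 :: w) ↔ Reads v .even p q w := by
  unfold Reads
  rw [sourceVertex, normalForm]
  rcases sourceVertex v w with _ | _ | _ <;> rcases normalForm w with _ | s <;>
    simp [vertexStep, monoidStep]

theorem not_reads_one_odd {v : EvenVertex} {p q : List Γ} {w : List (Sym Γ)} :
    ¬ Reads v .odd p q (.inl 1 :: w) := by
  unfold Reads
  rw [sourceVertex]
  rcases sourceVertex v w with _ | _ | _ <;> simp [vertexStep]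

theorem not_reads_loop_odd {v : EvenVertex} {p q : List Γ} {w : List (Sym Γ)}
    {s : LoopSym (fun _ : Γ => 1) (fun _ : Γ => 1)} : ¬ Reads v .odd p q (.inr s :: w) := by
  unfold Reads
  rw [sourceVertex]
  rcases sourceVertex v w with _ | _ | _ <;> simp [vertexStep]

theorem reads_neg_even {v : EvenVertex} {p q : List Γ} {γ : Γ} {w : List (Sym Γ)} :
    Reads v .even p q (.inr (.neg γ 0) :: w) ↔
      Reads v .even (γ :: p) q w ∨ p = [] ∧ ∃ q', q = γ :: q' ∧ Reads v .even [] q' w := by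
  unfold Reads
  rw [sourceVertex, normalForm]
  rcases sourceVertex v w with _ | _ | _ <;> rcases normalForm w with _ | ⟨_ | ⟨γ', p'⟩, q'⟩ <;>
    simp [vertexStep, monoidStep]
  · grind
  · grind

theorem reads_pos_even {v : EvenVertex} {p q : List Γ} {γ : Γ} {w : List (Sym Γ)} :
    Reads v .even p q (.inr (.pos γ 0) :: w) ↔
      ∃ p', p = γ :: p' ∧ Reads v .even p' q w := by
  unfold Reads
  rw [sourceVertex, normalForm]
  rcases sourceVertex v w with _ | _ | _ <;> rcases normalForm w with _ | ⟨p', q'⟩ <;>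
    simp [vertexStep, monoidStep]
  grind

variable [Fintype Γ]

theorem wordCount_reads_odd_succ (v : EvenVertex) (n : ℕ) (p q : List Γ) :
    wordCount (n + 1) (Reads v .odd p q) = wordCount n (Reads v .even p q) := by
  rw [wordCount_succ, sum_sym]
  simp only [reads_zero_odd]
  rw [wordCount_eq_zero (fun w _ => not_reads_one_odd),
    Finset.sum_eq_zero fun γ _ => wordCount_eq_zero (fun w _ => not_reads_loop_odd),
    Finset.sum_eq_zero fun γ _ => wordCount_eq_zero (fun w _ => not_reads_loop_odd)]
  rfl

/-- The contribution to `wordCount (n + 1) (Reads v .even p q)` of the first letters that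
lengthen the normal form. -/
noncomputable def wordCountPred (v : EvenVertex) (n : ℕ) : List Γ → List Γ → ℕ
  | [], [] => 0
  | [], _ :: q => wordCount n (Reads v .even [] q)
  | _ :: p, q => wordCount n (Reads v .even p q)

theorem wordCount_reads_even_succ (v : EvenVertex) (n : ℕ) (p q : List Γ) :
    wordCount (n + 1) (Reads v .even p q)
      = wordCount n (Reads v .odd p q) + wordCount n (Reads v .even p q)
        + (∑ γ, wordCount n (Reads v .even (γ :: p) q) + wordCountPred v n p q) := by
  classical
  rw [wordCount_succ, sum_sym]
  simp only [reads_zero_even, reads_one_even, reads_neg_even, reads_pos_even]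
  congr 1
  -- The two cases are disjoint: the remaining word has a nonempty positive part in one and an empty
  -- one in the other.
  have hor : ∀ γ, wordCount n (fun w => Reads v .even (γ :: p) q w
        ∨ p = [] ∧ ∃ q', q = γ :: q' ∧ Reads v .even [] q' w)
      = wordCount n (Reads v .even (γ :: p) q)
        + wordCount n (fun w => p = [] ∧ ∃ q', q = γ :: q' ∧ Reads v .even [] q' w) := by
    intro γ
    apply wordCount_or
    rintro w - ⟨-, h1⟩ ⟨-, q', -, -, h2⟩
    simp [h1] at h2
  rw [Finset.sum_congr rfl fun γ _ => hor γ, Finset.sum_add_distrib, add_assoc]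
  congr 1
  match p, q with
  | [], [] => simp [wordCountPred, wordCount_eq_zero]
  | [], γ :: q =>
    simp only [wordCountPred]
    rw [Finset.sum_eq_single γ]
    · rw [Finset.sum_eq_zero fun γ _ => wordCount_eq_zero (fun w _ => by simp), add_zero]
      exact wordCount_congr fun w _ => by simp
    · intro γ' _ h
      exact wordCount_eq_zero fun w _ => by simp [Ne.symm h]
    · simp
  | γ :: p, q =>
    simp only [wordCountPred]
    rw [Finset.sum_eq_zero fun γ _ => wordCount_eq_zero (fun w _ => by simp), zero_add,
      Finset.sum_eq_single γ]
    · exact wordCount_congr fun w _ => by simp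
    · intro γ' _ h
      exact wordCount_eq_zero fun w _ => by simp [Ne.symm h]
    · simp

/-- The generating function of the words that label a path from `u` to `v` and whose normal form
has length `m`, for a fixed normal form. -/
noncomputable def readSeries (N : ℕ) : EvenVertex → EvenVertex → ℕ → ℚ⟦X⟧
  | .even, .even, m => dyckSeries N * (X * dyckSeries N) ^ m
  | .even, .odd, m => X * (dyckSeries N * (X * dyckSeries N) ^ m)
  | .odd, .even, m => X * (dyckSeries N * (X * dyckSeries N) ^ m)
  | .odd, .odd, m => 0 ^ m + X * (X * (dyckSeries N * (X * dyckSeries N) ^ m))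

theorem coeff_readSeries_odd_succ (N : ℕ) (v : EvenVertex) (n m : ℕ) :
    coeff (n + 1) (readSeries N v .odd m) = coeff n (readSeries N v .even m) := by
  cases v
  · simp [readSeries, coeff_succ_X_mul]
  · cases m <;> simp [readSeries, coeff_succ_X_mul, coeff_one]

theorem coeff_zero_dyckSeries (N : ℕ) : coeff 0 (dyckSeries N) = 1 := by
  have h := congrArg constantCoeff (dyckSeries_eq N)
  simpa using h

theorem readSeries_even_zero (N : ℕ) (v : EvenVertex) (n : ℕ) :
    coeff (n + 1) (readSeries N v .even 0) = coeff n (readSeries N v .odd 0)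
      + coeff n (readSeries N v .even 0) + N * coeff n (readSeries N v .even 1) := by
  have hD := dyckSeries_eq N
  have hN : (N : ℚ⟦X⟧) = C (N : ℚ) := by simp
  -- `e` accounts for the empty word: 1 if the path ends in `even`, 0 if it ends in `odd`.
  have h (e : ℚ⟦X⟧) (he : readSeries N v .even 0 = e + X * (readSeries N v .odd 0
      + readSeries N v .even 0 + C (N : ℚ) * readSeries N v .even 1))
      (he' : coeff (n + 1) e = 0) : coeff (n + 1) (readSeries N v .even 0)
        = coeff n (readSeries N v .odd 0)
      + coeff n (readSeries N v .even 0) + N * coeff n (readSeries N v .even 1) := by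
    conv_lhs => rw [he]
    rw [map_add, he', coeff_succ_X_mul, map_add, map_add, coeff_C_mul, zero_add]
  cases v
  · refine h 1 ?_ (by simp [coeff_one])
    simp only [readSeries, ← hN]
    linear_combination hD
  · refine h 0 ?_ (by simp)
    simp only [readSeries, ← hN]
    linear_combination X * hD

/-- The equation of D times a power of XD; its constant 1 now produces the term with normal form
shorter by one. -/
theorem readSeries_even_succ (N : ℕ) (v : EvenVertex) (n m : ℕ) :
    coeff (n + 1) (readSeries N v .even (m + 1)) = coeff n (readSeries N v .odd (m + 1))
      + coeff n (readSeries N v .even (m + 1)) + N * coeff n (readSeries N v .even (m + 2))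
      + coeff n (readSeries N v .even m) := by
  have hD := dyckSeries_eq N
  have hN : (N : ℚ⟦X⟧) = C (N : ℚ) := by simp
  have h : readSeries N v .even (m + 1) = X * (readSeries N v .odd (m + 1)
      + readSeries N v .even (m + 1) + C (N : ℚ) * readSeries N v .even (m + 2)
      + readSeries N v .even m) := by
    cases v
    · simp only [readSeries, ← hN]
      linear_combination (X * dyckSeries N) ^ (m + 1) * hD
    · simp only [readSeries, ← hN]
      linear_combination X * (X * dyckSeries N) ^ (m + 1) * hD
  conv_lhs => rw [h]
  rw [coeff_succ_X_mul, map_add, map_add, map_add, coeff_C_mul]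

/-- Induction by removing the first letter. A letter `neg γ` comes from a form longer by one, for
each of the N letters γ; a nonempty form has exactly one shorter predecessor. Thus only the total
length enters the recursion. -/
theorem wordCount_reads (v u : EvenVertex) (n : ℕ) (p q : List Γ) :
    (wordCount n (Reads v u p q) : ℚ)
      = coeff n (readSeries (Fintype.card Γ) v u (p.length + q.length)) := by
  induction n generalizing u p q with
  | zero =>
    classical
    rw [wordCount_zero]
    simp only [reads_nil]
    have hD := coeff_zero_dyckSeries (Fintype.card Γ)
    rw [coeff_zero_eq_constantCoeff_apply] at hD
    cases v <;> cases u <;> rcases p with _ | ⟨γ, p⟩ <;> rcases q with _ | ⟨γ', q⟩ <;>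
      simp [readSeries, hD]
  | succ n ih =>
    cases u
    · rw [wordCount_reads_even_succ]
      push_cast
      simp only [ih]
      match p, q with
      | [], [] =>
        simp [wordCountPred, readSeries_even_zero]
      | [], γ :: q =>
        simp only [wordCountPred, ih]
        have h := readSeries_even_succ (Fintype.card Γ) v n q.length
        simp only [List.length_cons, List.length_nil, zero_add, Finset.sum_const,
          Finset.card_univ, nsmul_eq_mul]
        rw [h, show 1 + (q.length + 1) = q.length + 2 by omega]
        ring
      | γ :: p, q =>
        simp only [wordCountPred, ih]
        have h := readSeries_even_succ (Fintype.card Γ) v n (p.length + q.length)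
        simp only [List.length_cons, Finset.sum_const,
          Finset.card_univ, nsmul_eq_mul]
        rw [show p.length + 1 + q.length = p.length + q.length + 1 by omega, h,
          show p.length + 1 + 1 + q.length = p.length + q.length + 2 by omega]
        ring
    · rw [wordCount_reads_odd_succ, ih, coeff_readSeries_odd_succ]

end Schroeder

/-! ### Inclusion–exclusion and disjoint unions for word counts -/

section WordCount

variable {A : Type*} [Fintype A]

theorem wordCount_or_add_and (n : ℕ) (P Q : List A → Prop) :
    wordCount n (fun w => P w ∨ Q w) + wordCount n (fun w => P w ∧ Q w)
      = wordCount n P + wordCount n Q := by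
  classical
  unfold wordCount
  rw [← Finset.card_union_add_card_inter (Finset.univ.filter fun w => P (List.ofFn w))]
  congr 2 <;> ext w <;> simp

theorem wordCount_exists {ι : Type*} {n : ℕ} (s : Finset ι) (P : ι → List A → Prop)
    (h : ∀ i ∈ s, ∀ j ∈ s, ∀ w, P i w → P j w → i = j) :
    wordCount n (fun w => ∃ i ∈ s, P i w) = ∑ i ∈ s, wordCount n (P i) := by
  classical
  unfold wordCount
  rw [← Finset.card_biUnion]
  · congr 1
    ext w
    simp
  · intro i hi j hj hij
    rw [Function.onFun, Finset.disjoint_left]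
    intro w hw hw'
    exact hij (h i hi j hj (List.ofFn w) (by simpa using hw) (by simpa using hw'))

theorem wordCount_forall_eq (n : ℕ) (a : A) :
    wordCount n (fun w => ∀ b ∈ w, b = a) = 1 := by
  unfold wordCount
  rw [Finset.card_eq_one]
  refine ⟨fun _ => a, ?_⟩
  ext w
  simp [funext_iff]

end WordCount

/-! ### Counting cycles and period words -/

namespace Schroeder

open DyckMonoid

variable {Γ : Type*}

theorem exists_ofFn_eq {A : Type*} (n : ℕ) (L : List A) (h : L.length = n) :
    ∃ l : Fin n → A, List.ofFn l = L := by
  subst h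
  exact ⟨L.get, List.ofFn_get L⟩

/-- The words that label a closed path at `v` and whose powers have nonzero image. -/
def IsCycle (v : EvenVertex) (w : List (Sym Γ)) : Prop :=
  ∃ p q, Compatible p q ∧ Reads v v p q w

/-- The index set of the compatible normal forms of length at most `n`: a compatible pair is given
by the lengths of its components and the longer component. -/
def compatibleIndex (Γ : Type*) [Fintype Γ] (n : ℕ) :
    Finset (Σ x : (Σ _ : ℕ, ℕ × ℕ), Fin (max x.2.1 x.2.2) → Γ) :=
  letI := Classical.decEq Γ
  ((Finset.range (n + 1)).sigma fun m => Finset.HasAntidiagonal.antidiagonal m).sigma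
    fun _ => Finset.univ

theorem mem_compatibleIndex [Fintype Γ] {n : ℕ}
    {x : Σ x : (Σ _ : ℕ, ℕ × ℕ), Fin (max x.2.1 x.2.2) → Γ} :
    x ∈ compatibleIndex Γ n ↔ x.1.1 < n + 1 ∧ x.1.2.1 + x.1.2.2 = x.1.1 := by
  simp [compatibleIndex]

theorem isCycle_iff [Fintype Γ] {v : EvenVertex} {w : List (Sym Γ)} {n : ℕ} (hw : w.length = n) :
    IsCycle v w ↔ ∃ x ∈ compatibleIndex Γ n,
      Reads v v ((List.ofFn x.2).take x.1.2.1) ((List.ofFn x.2).take x.1.2.2).reverse w := by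
  constructor
  · rintro ⟨p, q, hc, hr⟩
    have hl := length_normalForm hr.2
    -- L is the longer of p and the reverse of q; both are prefixes of it.
    suffices h : ∃ L : List Γ, L.length = max p.length q.length ∧ L.take p.length = p ∧
        L.take q.length = q.reverse by
      obtain ⟨L, hL, h1, h2⟩ := h
      obtain ⟨l, hl'⟩ := exists_ofFn_eq _ L hL
      refine ⟨⟨⟨p.length + q.length, p.length, q.length⟩, l⟩, ?_, ?_⟩
      · rw [mem_compatibleIndex]
        exact ⟨by simp only; omega, rfl⟩
      · simp only
        rw [hl', h1, h2, List.reverse_reverse]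
        exact hr
    rcases hc with hc | hc
    · have := hc.length_le
      rw [List.length_reverse] at this
      refine ⟨p, by omega, by simp, ?_⟩
      have h := List.prefix_iff_eq_take.mp hc
      rw [List.length_reverse] at h
      exact h.symm
    · have := hc.length_le
      rw [List.length_reverse] at this
      refine ⟨q.reverse, by simp; omega, ?_, by simp [List.take_of_length_le]⟩
      exact (List.prefix_iff_eq_take.mp hc).symm
  · rintro ⟨⟨⟨m, i, j⟩, l⟩, -, hr⟩
    refine ⟨_, _, ?_, hr⟩
    unfold Compatible
    rw [List.reverse_reverse]
    rcases le_total i j with h | h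
    · exact Or.inr (List.take_prefix_take_left h)
    · exact Or.inl (List.take_prefix_take_left h)

theorem wordCount_isCycle [Fintype Γ] (v : EvenVertex) (n : ℕ) :
    (wordCount n (IsCycle (Γ := Γ) v) : ℚ)
      = ∑ m ∈ Finset.range (n + 1), (∑ ij ∈ Finset.HasAntidiagonal.antidiagonal m,
          (Fintype.card Γ : ℚ) ^ max ij.1 ij.2) * coeff n (readSeries (Fintype.card Γ) v v m) := by
  rw [wordCount_congr (fun w hw => isCycle_iff hw), wordCount_exists]
  · push_cast
    simp only [wordCount_reads]
    rw [compatibleIndex, Finset.sum_sigma, Finset.sum_sigma]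
    refine Finset.sum_congr rfl fun m _ => ?_
    rw [Finset.sum_mul]
    refine Finset.sum_congr rfl fun ij hij => ?_
    have hij' := Finset.HasAntidiagonal.mem_antidiagonal.mp hij
    simp [hij']
  -- The word determines its normal form, hence both lengths, and the longer component is all of
  -- `l`.
  · rintro ⟨⟨m, i, j⟩, l⟩ hx ⟨⟨m', i', j'⟩, l'⟩ hx' w hr hr'
    rw [mem_compatibleIndex] at hx hx'
    have h := hr.2.symm.trans hr'.2
    simp only [Option.some.injEq, Prod.mk.injEq, List.reverse_inj] at h hx hx'
    obtain ⟨h1, h2⟩ := h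
    have hi := congrArg List.length h1
    have hj := congrArg List.length h2
    simp only [List.length_take, List.length_ofFn] at hi hj
    obtain rfl : i = i' := by omega
    obtain rfl : j = j' := by omega
    obtain rfl : m = m' := by omega
    congr 1
    apply List.ofFn_injective
    rcases le_total i j with h | h
    · rwa [List.take_of_length_le (by simp [h]), List.take_of_length_le (by simp [h])] at h2
    · rwa [List.take_of_length_le (by simp [h]), List.take_of_length_le (by simp [h])] at h1

theorem sourceVertex_append (v : EvenVertex) (a b : List (Sym Γ)) :
    sourceVertex v (a ++ b) = (sourceVertex v b).bind fun u => sourceVertex u a := by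
  induction a with
  | nil => simp [sourceVertex]
  | cons c a ih =>
    rw [List.cons_append, sourceVertex, ih, Option.bind_assoc]
    rfl

/-- A word that contains a symbol different from `0` determines the source of its paths. -/
theorem sourceVertex_synchronizes {w : List (Sym Γ)} {v v' u u' : EvenVertex}
    (h : sourceVertex v w = some u) (h' : sourceVertex v' w = some u') :
    (∀ a ∈ w, a = .inl 0) ∨ u = u' := by
  induction w generalizing u u' with
  | nil => simp
  | cons c w ih =>
    rw [sourceVertex, Option.bind_eq_some_iff] at h h'
    obtain ⟨t, ht, h⟩ := h
    obtain ⟨t', ht', h'⟩ := h'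
    rcases ih ht ht' with h0 | rfl
    · by_cases hc : c = .inl 0
      · left; simpa [hc] using h0
      · right
        rcases c with c | c <;> cases t <;> cases t' <;> simp_all [vertexStep]
    · right
      exact Option.some_injective _ (h.symm.trans h')

theorem normalForm_of_forall_eq_zero {w : List (Sym Γ)} (h : ∀ a ∈ w, a = .inl 0) :
    normalForm w = some ([], []) := by
  induction w with
  | nil => rfl
  | cons c w ih =>
    rw [List.forall_mem_cons] at h
    rw [normalForm, ih h.2, h.1]
    rfl

/-- The other vertex. -/
def otherVertex : EvenVertex → EvenVertex
  | .even => .odd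
  | .odd => .even

theorem sourceVertex_of_forall_eq_zero {w : List (Sym Γ)} (h : ∀ a ∈ w, a = .inl 0)
    (v : EvenVertex) : sourceVertex v w = some (otherVertex^[w.length] v) := by
  induction w with
  | nil => rfl
  | cons c w ih =>
    rw [List.forall_mem_cons] at h
    rw [sourceVertex, ih h.2, h.1, List.length_cons, Function.iterate_succ_apply',
      Option.bind_some]
    cases otherVertex^[w.length] v <;> rfl

theorem isCycle_iff_even_of_forall_eq_zero {w : List (Sym Γ)} (h : ∀ a ∈ w, a = .inl 0)
    (v : EvenVertex) : IsCycle v w ↔ Even w.length := by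
  have hinv : Function.Involutive otherVertex := fun v => by cases v <;> rfl
  have h1 : IsCycle v w ↔ otherVertex^[w.length] v = v := by
    simp only [IsCycle, Reads, sourceVertex_of_forall_eq_zero h, normalForm_of_forall_eq_zero h]
    constructor
    · rintro ⟨p, q, -, h, -⟩
      exact Option.some_injective _ h
    · intro h
      exact ⟨[], [], by simp [Compatible], by rw [h], rfl⟩
  rw [h1]
  rcases Nat.even_or_odd w.length with he | ho
  · rw [hinv.iterate_even he]; simp [he]
  · rw [hinv.iterate_odd ho]
    simp only [← Nat.not_odd_iff_even, ho, not_true, iff_false]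
    cases v <;> simp [otherVertex]

/-- The words whose periodic continuation lies in the Schröder shift. -/
def IsPeriodWord (w : List (Sym Γ)) : Prop :=
  (IsCycle .even w ∨ IsCycle .odd w) ∨ ∀ a ∈ w, a = .inl 0

theorem forall_eq_zero_of_isCycle {w : List (Sym Γ)} (h : IsCycle .even w) (h' : IsCycle .odd w) :
    ∀ a ∈ w, a = .inl 0 := by
  obtain ⟨_, _, -, h, -⟩ := h
  obtain ⟨_, _, -, h', -⟩ := h'
  simpa using sourceVertex_synchronizes h h'

/-- For even n the word 0ⁿ is the one cycle shared by both vertices. For odd n it is a cycle at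
neither, yet its repetition is admissible. -/
theorem wordCount_isPeriodWord [Fintype Γ] (n : ℕ) :
    (wordCount n (IsPeriodWord (Γ := Γ)) : ℚ)
      = wordCount n (IsCycle (Γ := Γ) .even) + wordCount n (IsCycle (Γ := Γ) .odd)
        - (-1) ^ n := by
  have h1 := wordCount_or_add_and n (IsCycle (Γ := Γ) .even) (IsCycle .odd)
  have h2 := wordCount_or_add_and n (fun w => IsCycle (Γ := Γ) .even w ∨ IsCycle .odd w)
    (fun w => ∀ a ∈ w, a = .inl 0)
  beta_reduce at h2
  have h3 : wordCount n (fun w : List (Sym Γ) => ∀ a ∈ w, a = .inl 0) = 1 :=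
    wordCount_forall_eq n _
  have h4 : wordCount n (IsPeriodWord (Γ := Γ)) = wordCount n (fun w : List (Sym Γ) =>
    (IsCycle .even w ∨ IsCycle .odd w) ∨ ∀ a ∈ w, a = .inl 0) := rfl
  rcases Nat.even_or_odd n with he | ho
  · have h5 : wordCount n (fun w => IsCycle (Γ := Γ) .even w ∧ IsCycle .odd w)
        = wordCount n (fun w : List (Sym Γ) => ∀ a ∈ w, a = .inl 0) := by
      refine wordCount_congr fun w hw => ⟨fun h => forall_eq_zero_of_isCycle h.1 h.2, fun h => ?_⟩
      simp [isCycle_iff_even_of_forall_eq_zero h, hw, he]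
    have h6 : wordCount n (fun w => (IsCycle (Γ := Γ) .even w ∨ IsCycle .odd w)
          ∧ ∀ a ∈ w, a = .inl 0)
        = wordCount n (fun w : List (Sym Γ) => ∀ a ∈ w, a = .inl 0) := by
      refine wordCount_congr fun w hw => ⟨fun h => h.2, fun h => ⟨?_, h⟩⟩
      simp [isCycle_iff_even_of_forall_eq_zero h, hw, he]
    rw [he.neg_one_pow, eq_sub_iff_add_eq]
    norm_cast
    omega
  · have hn (w : List (Sym Γ)) (hw : w.length = n) (h : ∀ a ∈ w, a = .inl 0) (v : EvenVertex) :
        ¬ IsCycle v w := by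
      rw [isCycle_iff_even_of_forall_eq_zero h, hw]
      exact Nat.not_even_iff_odd.mpr ho
    have h5 : wordCount n (fun w => IsCycle (Γ := Γ) .even w ∧ IsCycle .odd w) = 0 :=
      wordCount_eq_zero fun w hw h => hn w hw (forall_eq_zero_of_isCycle h.1 h.2) _ h.1
    have h6 : wordCount n (fun w => (IsCycle (Γ := Γ) .even w ∨ IsCycle .odd w)
          ∧ ∀ a ∈ w, a = .inl 0) = 0 :=
      wordCount_eq_zero fun w hw h => h.1.elim (hn w hw h.2 _) (hn w hw h.2 _)
    rw [ho.neg_one_pow, sub_neg_eq_add]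
    norm_cast
    omega

end Schroeder

/-! ### Paths, admissible words and their powers -/

namespace Schroeder

open DyckMonoid

variable {Γ : Type*}

/-- The Schröder graph. -/
abbrev graph (Γ : Type*) := evenAutomaton.attachLoops EvenVertex.even
  (fun _ : Γ => 1) (fun _ : Γ => 1)

/-- Label and target determine the source of an edge. Together with `exists_edge` this lets the
backward automaton replace paths in the graph. -/
theorem vertexStep_lab (e : EvenEdge ⊕ LoopSym (fun _ : Γ => 1) (fun _ : Γ => 1)) :
    vertexStep ((graph Γ).lab e) ((graph Γ).tgt e) = some ((graph Γ).src e) := by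
  rcases e with (_ | _ | _) | e <;>
    simp [vertexStep, LabeledGraph.attachLoops, evenAutomaton]

theorem exists_edge {a : Sym Γ} {t u : EvenVertex} (h : vertexStep a t = some u) :
    ∃ e, (graph Γ).lab e = a ∧ (graph Γ).tgt e = t ∧ (graph Γ).src e = u := by
  rcases a with a | a
  · fin_cases a <;> cases t <;> cases u <;> simp [vertexStep] at h
    · exact ⟨.inl .oddToEven, by simp [LabeledGraph.attachLoops, evenAutomaton]⟩
    · exact ⟨.inl .evenToOdd, by simp [LabeledGraph.attachLoops, evenAutomaton]⟩
    · exact ⟨.inl .loop, by simp [LabeledGraph.attachLoops, evenAutomaton]⟩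
  · cases t <;> cases u <;> simp [vertexStep] at h
    exact ⟨.inr a, by simp [LabeledGraph.attachLoops]⟩

theorem sourceVertex_of_isPath
    (p : List (EvenEdge ⊕ LoopSym (fun _ : Γ => 1) (fun _ : Γ => 1)))
    (hp : (graph Γ).IsPath p) : ∃ v u, sourceVertex v (p.map (graph Γ).lab) = some u ∧
      ∀ e ∈ p.head?, (graph Γ).src e = u := by
  induction p with
  | nil => exact ⟨.even, .even, rfl, by simp⟩
  | cons e p ih =>
    rw [LabeledGraph.IsPath, List.isChain_cons] at hp
    obtain ⟨h1, h2⟩ := hp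
    obtain ⟨v, u, h, hu⟩ := ih h2
    rcases p with _ | ⟨f, p⟩
    · refine ⟨(graph Γ).tgt e, (graph Γ).src e, ?_, by simp⟩
      exact vertexStep_lab e
    · refine ⟨v, (graph Γ).src e, ?_, by simp⟩
      rw [List.map_cons, sourceVertex, h, Option.bind_some, ← hu f (by simp), ← h1 f (by simp)]
      exact vertexStep_lab e

theorem exists_isPath {v u : EvenVertex} {w : List (Sym Γ)} (h : sourceVertex v w = some u) :
    ∃ p, (graph Γ).IsPath p ∧ p.map (graph Γ).lab = w ∧ ∀ e ∈ p.head?, (graph Γ).src e = u := by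
  induction w generalizing u with
  | nil => exact ⟨[], List.isChain_nil, rfl, by simp⟩
  | cons a w ih =>
    rw [sourceVertex, Option.bind_eq_some_iff] at h
    obtain ⟨t, ht, h⟩ := h
    obtain ⟨p, hp, hw, hs⟩ := ih ht
    obtain ⟨e, he, het, hes⟩ := exists_edge h
    refine ⟨e :: p, ?_, by rw [List.map_cons, he, hw], by simpa using hes⟩
    rw [LabeledGraph.IsPath, List.isChain_cons]
    exact ⟨fun f hf => het.trans (hs f hf).symm, hp⟩

/-- The admissible words of the Schröder shift. -/
abbrev Admissible (w : List (Sym Γ)) : Prop :=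
  evenAutomaton.AdmissibleWord EvenVertex.even (fun _ : Γ => 1) (fun _ : Γ => 1) w

theorem admissible_iff (w : List (Sym Γ)) :
    Admissible w ↔ (∃ v u, sourceVertex v w = some u) ∧
      (w.map LabeledGraph.phi).prod ≠ zero Γ := by
  constructor
  · rintro ⟨p, ⟨hp, h0⟩, rfl⟩
    obtain ⟨v, u, h, -⟩ := sourceVertex_of_isPath p hp
    exact ⟨⟨v, u, h⟩, h0⟩
  · rintro ⟨⟨v, u, h⟩, h0⟩
    obtain ⟨p, hp, hw, -⟩ := exists_isPath h
    exact ⟨p, ⟨hp, by rwa [hw]⟩, hw⟩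

theorem Admissible.of_infix {a b c : List (Sym Γ)} (h : Admissible (a ++ (b ++ c))) :
    Admissible b := by
  rw [admissible_iff] at h ⊢
  obtain ⟨⟨v, u, h⟩, h0⟩ := h
  constructor
  · rw [sourceVertex_append, Option.bind_eq_some_iff] at h
    obtain ⟨t, h, -⟩ := h
    rw [sourceVertex_append, Option.bind_eq_some_iff] at h
    obtain ⟨s, -, h⟩ := h
    exact ⟨s, t, h⟩
  · intro hb
    rw [List.map_append, List.map_append, List.prod_append, List.prod_append, hb, zero_mul',
      mul_zero'] at h0
    exact h0 rfl

theorem sourceVertex_flatten_replicate {v : EvenVertex} {w : List (Sym Γ)}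
    (h : sourceVertex v w = some v) (k : ℕ) :
    sourceVertex v (List.replicate k w).flatten = some v := by
  induction k with
  | zero => rfl
  | succ k ih =>
    rw [List.replicate_succ, List.flatten_cons, sourceVertex_append, ih, Option.bind_some, h]

theorem admissible_flatten_replicate {w : List (Sym Γ)} (h : IsPeriodWord w) (k : ℕ) :
    Admissible (List.replicate k w).flatten := by
  have hcyc (v : EvenVertex) (hv : IsCycle v w) : Admissible (List.replicate k w).flatten := by
    obtain ⟨p, q, hc, h1, h2⟩ := hv
    rw [admissible_iff]
    refine ⟨⟨v, v, sourceVertex_flatten_replicate h1 k⟩, ?_⟩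
    rw [List.map_flatten, List.prod_flatten, List.map_replicate, List.map_replicate,
      List.prod_replicate]
    exact prod_pow_ne_zero h2 hc k
  rcases h with (h | h) | h
  · exact hcyc _ h
  · exact hcyc _ h
  · have h' : ∀ a ∈ (List.replicate k w).flatten, a = .inl 0 := by
      intro a ha
      obtain ⟨l, hl, hal⟩ := List.mem_flatten.mp ha
      rw [List.eq_of_mem_replicate hl] at hal
      exact h a hal
    rw [admissible_iff, prod_map_phi_ne_zero_iff]
    exact ⟨⟨.even, _, sourceVertex_of_forall_eq_zero h' _⟩, _, normalForm_of_forall_eq_zero h'⟩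

/-- The two copies of w are read from vertices v and t and lead back to t and u. Unless w consists
of zeros, synchronization gives t = u, so w is a cycle there. -/
theorem isPeriodWord_of_admissible {w : List (Sym Γ)} (h : Admissible (w ++ w)) :
    IsPeriodWord w := by
  rw [admissible_iff] at h
  obtain ⟨⟨v, u, h⟩, h0⟩ := h
  obtain ⟨p, q, hw, hc⟩ := exists_compatible_of_prod_ne_zero h0
  rw [sourceVertex_append, Option.bind_eq_some_iff] at h
  obtain ⟨t, h1, h2⟩ := h
  have hcyc (v : EvenVertex) (hv : sourceVertex v w = some v) : IsPeriodWord w := by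
    left
    cases v
    · exact Or.inl ⟨p, q, hc, hv, hw⟩
    · exact Or.inr ⟨p, q, hc, hv, hw⟩
  rcases sourceVertex_synchronizes h1 h2 with h | rfl
  · exact Or.inr h
  · exact hcyc _ h2

/-! ### Periodic points of the Schröder shift -/

/-- The word of length `n` that appears in `x` at `i`. -/
def block {A : Type*} (x : ℤ → A) (i : ℤ) (n : ℕ) : List A := List.ofFn fun k : Fin n => x (i + k)

theorem block_add {A : Type*} (x : ℤ → A) (i : ℤ) (m n : ℕ) :
    block x i (m + n) = block x i m ++ block x (i + m) n := by
  rw [block, List.ofFn_add]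
  simp [block, add_assoc]

theorem block_mul {A : Type*} {x : ℤ → A} {n : ℕ} (hx : Function.Periodic x n) (k : ℕ) :
    block x 0 (k * n) = (List.replicate k (block x 0 n)).flatten := by
  induction k with
  | zero => simp [block]
  | succ k ih =>
    rw [List.replicate_succ', List.flatten_append, ← ih, Nat.succ_mul, block_add]
    congr 1
    have h (j : Fin n) : x (0 + (k * n : ℕ) + j) = x (0 + j) := by
      have := hx.nat_mul k (0 + j)
      rw [← this]
      push_cast
      congr 1
      ring
    simp only [block, h, List.flatten_singleton]

theorem iterate_shiftMap {A : Type*} (x : ℤ → A) (n : ℕ) (i : ℤ) :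
    shiftMap^[n] x i = x (i + n) := by
  induction n generalizing i with
  | zero => simp
  | succ n ih =>
    rw [Function.iterate_succ_apply', shiftMap, ih]
    push_cast
    congr 1
    ring

theorem isPeriodicPt_shiftMap_iff {A : Type*} {x : ℤ → A} {n : ℕ} :
    Function.IsPeriodicPt shiftMap n x ↔ Function.Periodic x n := by
  rw [Function.IsPeriodicPt, Function.IsFixedPt, funext_iff]
  simp only [iterate_shiftMap]
  rfl

theorem mem_schroederShift_iff {x : ℤ → Sym Γ} {n : ℕ} (hn : 0 < n)
    (hx : Function.Periodic x n) : x ∈ schroederShift Γ ↔ IsPeriodWord (block x 0 n) := by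
  constructor
  · intro h
    apply isPeriodWord_of_admissible
    have h2 : Admissible (block x 0 (2 * n)) := h 0 (2 * n)
    rw [block_mul hx] at h2
    simpa [List.replicate] using h2
  · intro h i m
    change Admissible (block x i m)
    have hi : block x i m = block x (i % n) m := by
      unfold block
      congr 1
      ext k : 1
      have h1 := hx.int_mul (i / n) (i % n + k)
      rw [← h1]
      congr 1
      have := Int.emod_add_mul_ediv i n
      simp only [Int.cast_id]
      linarith
    have hnn : 0 ≤ i % (n : ℤ) := Int.emod_nonneg i (by omega)
    obtain ⟨j, hj⟩ := Int.eq_ofNat_of_zero_le hnn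
    -- Since n ≥ 1, j + m periods are long enough to contain the block of length m at offset j.
    obtain ⟨r, hr⟩ := Nat.exists_eq_add_of_le (Nat.le_mul_of_pos_right (j + m) hn)
    have h2 := admissible_flatten_replicate h (j + m)
    rw [← block_mul hx, hr, add_assoc, block_add, block_add, zero_add] at h2
    rw [hi, hj]
    exact h2.of_infix

theorem ncard_periodicPoints [Fintype Γ] {n : ℕ} (hn : 0 < n) :
    (periodicPoints (schroederShift Γ) n).ncard = wordCount n (IsPeriodWord (Γ := Γ)) := by
  classical
  have : NeZero n := ⟨hn.ne'⟩
  let r : (ℤ → Sym Γ) → Fin n → Sym Γ := fun x k => x (0 + (k : ℕ))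
  have hr (x : ℤ → Sym Γ) : List.ofFn (r x) = block x 0 n := rfl
  have hinj : Set.InjOn r (periodicPoints (schroederShift Γ) n) := by
    rintro x ⟨-, hx⟩ y ⟨-, hy⟩ hxy
    rw [isPeriodicPt_shiftMap_iff] at hx hy
    ext i : 1
    have h0 : 0 ≤ i % (n : ℤ) := Int.emod_nonneg i (by omega)
    have h1 : i % (n : ℤ) < n := Int.emod_lt_of_pos i (by omega)
    have h := congrFun hxy ⟨(i % n).toNat, by omega⟩
    have hx' := hx.int_mul (i / n) (i % n)
    have hy' := hy.int_mul (i / n) (i % n)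
    have hi : i % (n : ℤ) + ((i / n : ℤ) : ℤ) * n = i := by
      have := Int.emod_add_mul_ediv i n
      linarith
    simp only [Int.cast_id, hi] at hx' hy'
    simp only [r, Int.toNat_of_nonneg h0, zero_add] at h
    rw [hx', hy', h]
  rw [← hinj.ncard_image, wordCount, ← Set.ncard_coe_finset]
  congr 1
  ext w
  simp only [Set.mem_image, Finset.coe_filter, Finset.mem_univ, true_and, Set.mem_ofPred_eq]
  constructor
  · rintro ⟨x, ⟨hx, hp⟩, rfl⟩
    rw [isPeriodicPt_shiftMap_iff] at hp
    rw [hr]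
    exact (mem_schroederShift_iff hn hp).mp hx
  · intro hw
    have hlt (i : ℤ) : (i % (n : ℤ)).toNat < n := by
      have h1 : i % (n : ℤ) < n := Int.emod_lt_of_pos i (by omega)
      omega
    -- The periodic continuation of w.
    let x : ℤ → Sym Γ := fun i => w ⟨(i % n).toNat, hlt i⟩
    have hp : Function.Periodic x n := fun i => by simp [x]
    have hx : r x = w := by
      ext k : 1
      simp only [r, x]
      congr 1
      ext
      simp only [zero_add]
      rw [Int.emod_eq_of_lt (by omega) (by omega), Int.toNat_natCast]
    refine ⟨x, ⟨?_, isPeriodicPt_shiftMap_iff.mpr hp⟩, hx⟩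
    rw [mem_schroederShift_iff hn hp, ← hr, hx]
    exact hw

/-! ### Assembling the logarithmic derivative -/

theorem inv_one_add_X : (1 + X : ℚ⟦X⟧)⁻¹ = PowerSeries.mk fun n => (-1) ^ n := by
  symm
  rw [PowerSeries.eq_inv_iff_mul_eq_one (by simp)]
  ext n
  rw [mul_add, mul_one, map_add, coeff_mk]
  cases n with
  | zero => simp
  | succ n => simp [coeff_succ_mul_X, coeff_one, pow_succ]

/-- The summands 1 and X² in the first factor come from cycles at `even` and `odd`; -1 removes the
empty word, and X / (1 + X) is the correction for the words 0ⁿ. -/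
theorem X_mul_mk_ncard_periodicPoints [Fintype Γ] :
    X * (PowerSeries.mk fun n : ℕ => ((periodicPoints (schroederShift Γ) (n + 1)).ncard : ℚ))
      = (1 + X ^ 2) * dyckSeries (Fintype.card Γ) *
          (comparableSeries (Fintype.card Γ)).subst (X * dyckSeries (Fintype.card Γ))
          - 1 + X * (1 + X)⁻¹ := by
  set N := Fintype.card Γ
  rw [add_mul (1 : ℚ⟦X⟧), add_mul, one_mul, inv_one_add_X]
  ext n
  rw [map_add, map_sub, map_add, coeff_mul_subst_comparableSeries,
    coeff_mul_subst_comparableSeries]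
  cases n with
  | zero =>
    have hD := coeff_zero_dyckSeries N
    rw [coeff_zero_eq_constantCoeff_apply] at hD
    simp [hD]
  | succ n =>
    rw [coeff_succ_X_mul, coeff_succ_X_mul, coeff_mk, coeff_mk, ncard_periodicPoints n.succ_pos,
      wordCount_isPeriodWord, wordCount_isCycle, wordCount_isCycle]
    have h (m : ℕ) : coeff (n + 1) (readSeries N .odd .odd m)
        = coeff (n + 1) (X ^ 2 * dyckSeries N * (X * dyckSeries N) ^ m) := by
      -- This summand of `readSeries` records the empty word at `odd`, which is invisible in
      -- positive degree.
      have h0 : coeff (n + 1) ((0 : ℚ⟦X⟧) ^ m) = 0 := by cases m <;> simp [coeff_one]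
      rw [readSeries, map_add, h0, zero_add]
      congr 1
      ring
    simp only [N, h]
    simp only [readSeries]
    simp [coeff_one, pow_succ]

end Schroeder

theorem corollary2p9 (Γ : Type*) [Fintype Γ] (N : ℕ) (hN : Fintype.card Γ = N) (hN1 : 1 < N) :
    zetaSeries (schroederShift Γ) =
      (2 * (1 + X) *
        (1 - X - X ^ 2 + sqrtSeries ((1 - X - X ^ 2) ^ 2 - 4 * (N : ℚ⟦X⟧) * X ^ 2))) *
      ((1 - (2 * (N : ℚ⟦X⟧) + 1) * X - X ^ 2 +
        sqrtSeries ((1 - X - X ^ 2) ^ 2 - 4 * (N : ℚ⟦X⟧) * X ^ 2)) ^ 2)⁻¹ := by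
  rw [closedForm_eq]
  have hc : constantCoeff ((1 + X) * dyckSeries N *
      (1 - (N : ℚ⟦X⟧) * (X * dyckSeries N))⁻¹ ^ 2) = 1 := by
    have hD := Schroeder.coeff_zero_dyckSeries N
    rw [coeff_zero_eq_constantCoeff_apply] at hD
    simp [hD]
  refine PowerSeries.eq_of_logDeriv_eq (derivative_zetaSeries _) ?_ (by rw [hc]; exact one_ne_zero)
    (by rw [constantCoeff_zetaSeries, hc])
  apply mul_left_cancel₀ (PowerSeries.X_ne_zero (R := ℚ))
  rw [derivative_closedForm, ← hN, ← Schroeder.X_mul_mk_ncard_periodicPoints, mul_assoc]
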